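/- For real numbers $m,l$ let $F=1+m(x^2+y^2)$ and let the BCV space $M^3(m,l)$ be the domain $\{F>0\}\subset\mathbb{R}^3$ with the Riemannian metric $$h=\frac{dx^2+dy^2}{F^2}+\Big(dz+\frac{l}{2}\,\frac{y\,dx-x\,dy}{F}\Big)^2 .$$ The map $\pi(x,y,z)=(x,y)$ is a Riemannian submersion onto $B=(\{F>0\}\subset\mathbb{R}^2,\ (dx^2+dy^2)/F^2)$. As usual, $M^3(m,l)$ is called (locally) - $\mathbb{R}^3$ if $m=l=0$; - $S^2\times\mathbb{R}$ if $m>0$, $l=0$; - $H^2\times\mathbb{R}$ if $m<0$, $l=0$; - $S^3$ if $m>0$, $l^2=4m$; - $SU(2)$ if $m>0$, $l\neq0$, $l^2\neq4m$; - $\widetilde{SL}(2,\mathbb{R})$ if $m<0$, $l\neq0$; - $Nil$ if $m=0$, $l\neq0$. Let $\gamma=(x,y):I\to B$ be a smooth curve parametrized by arclength on an open interval $I$. Its Hopf cylinder is the surface $\pi^{-1}(\gamma(I))$, parametrized by $\varphi(s,z)=(x(s),y(s),z)$, $(s,z)\in I\times\mathbb{R}$. A proper biharmonic conformal immersion of the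 Hopf cylinder into $M^3(m,l)$ is a map $\varphi:(U,f^{-1}\varphi^*h)\to (M^3(m,l),h)$, where $U$ is $I\times\mathbb{R}$ or any open subset of it and $f:U\to(0,\infty)$ is any smooth function (constants allowed; the conformal factor is $f^{1/2}$), that is biharmonic but not harmonic. Here a map $\varphi:(M,g)\to(N,h)$ is harmonic if its tension field $\tau(\varphi)=\mathrm{Trace}_g\nabla d\varphi$ vanishes identically, and biharmonic if $$\tau_2(\varphi)=\mathrm{Trace}_g\big(\nabla^\varphi\nabla^\varphi-\nabla^\varphi_{\nabla^M}\big)\tau(\varphi)-\mathrm{Trace}_g R^N(d\varphi,\tau(\varphi))\,d\varphi$$ vanishes identically, where $R^N(X,Y)Z=[\nabla_X,\nabla_Y]Z-\nabla_{[X,Y]}Z$. Then: (i) If some Hopf cylinder admits a proper biharmonic conformal immersion into $M^3(m,l)$, then $M^3(m,l)$ is $S^2\times\mathbb{R}$, $H^2\times\mathbb{R}$, $\mathbb{R}^3$ or $SU(2)$. (ii) There is no proper biharmonic conformal immersion of a Hopf cylinder into $S^3$, $\widetilde{SL}(2,\mathbb{R})$ or $Nil$, whatever the conformal factor. -/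

import Mathlib

open scoped ContDiff Matrix

namespace BCV

/-! ### Riemannian geometry in coordinates

Points of a coordinate domain are vectors `Fin n → ℝ`.  A Riemannian metric is given by its
matrix of components `G p i j = ⟨∂ᵢ, ∂ⱼ⟩`, and a map by its component functions.  All
formulas below are only used on open sets where the metrics are smooth and positive definite. -/

/-- The partial derivative `∂ᵢ u` at `p`. -/
noncomputable def pd {n : ℕ} (i : Fin n) (u : (Fin n → ℝ) → ℝ) (p : Fin n → ℝ) : ℝ :=
  fderiv ℝ u p (Pi.single i 1)

/-- The Christoffel symbol `Γᵏᵢⱼ` of the Levi-Civita connection of the metric `G`. -/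
noncomputable def christoffel {n : ℕ} (G : (Fin n → ℝ) → Matrix (Fin n) (Fin n) ℝ)
    (k i j : Fin n) (p : Fin n → ℝ) : ℝ :=
  (1 / 2) * ∑ a, (G p)⁻¹ k a *
    (pd i (fun q => G q a j) p + pd j (fun q => G q a i) p - pd a (fun q => G q i j) p)

/-- The component `Rᵃ` of the curvature operator: `R(∂_c, ∂_d) ∂_b = ∑ₐ (curvature G a b c d) ∂ₐ`,
with the convention `R(X, Y) Z = ∇_X ∇_Y Z - ∇_Y ∇_X Z - ∇_[X, Y] Z`. -/
noncomputable def curvature {n : ℕ} (G : (Fin n → ℝ) → Matrix (Fin n) (Fin n) ℝ)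
    (a b c d : Fin n) (p : Fin n → ℝ) : ℝ :=
  pd c (christoffel G a d b) p - pd d (christoffel G a c b) p
    + ∑ e, (christoffel G a c e p * christoffel G e d b p
      - christoffel G a d e p * christoffel G e c b p)

/-- The components of the pull-back metric `φ^* h`. -/
noncomputable def pullbackMetric {k n : ℕ} (h : (Fin n → ℝ) → Matrix (Fin n) (Fin n) ℝ)
    (φ : (Fin k → ℝ) → (Fin n → ℝ)) (p : Fin k → ℝ) : Matrix (Fin k) (Fin k) ℝ :=
  Matrix.of fun i j =>
    ∑ a, ∑ b, h (φ p) a b * pd i (fun q => φ q a) p * pd j (fun q => φ q b) p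

/-- The pull-back connection `∇^φ_{∂ᵢ} W` on vector fields `W` along `φ : M → (N, h)`. -/
noncomputable def covDeriv {k n : ℕ} (h : (Fin n → ℝ) → Matrix (Fin n) (Fin n) ℝ)
    (φ : (Fin k → ℝ) → (Fin n → ℝ)) (i : Fin k) (W : (Fin k → ℝ) → (Fin n → ℝ))
    (p : Fin k → ℝ) : Fin n → ℝ :=
  fun a => pd i (fun q => W q a) p
    + ∑ b, ∑ c, christoffel h a b c (φ p) * pd i (fun q => φ q b) p * W p c

/-- The tension field `τ(φ) = Trace_g ∇dφ` of `φ : (M, g) → (N, h)`; here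
`(∇dφ)(∂ᵢ, ∂ⱼ) = ∇^φ_{∂ᵢ} (dφ ∂ⱼ) - dφ (∇^M_{∂ᵢ} ∂ⱼ)`. -/
noncomputable def tension {k n : ℕ} (g : (Fin k → ℝ) → Matrix (Fin k) (Fin k) ℝ)
    (h : (Fin n → ℝ) → Matrix (Fin n) (Fin n) ℝ) (φ : (Fin k → ℝ) → (Fin n → ℝ))
    (p : Fin k → ℝ) : Fin n → ℝ :=
  fun a => ∑ i, ∑ j, (g p)⁻¹ i j *
    (covDeriv h φ i (fun q b => pd j (fun r => φ r b) q) p a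
      - ∑ l, christoffel g l i j p * pd l (fun q => φ q a) p)

/-- The rough Laplacian `Trace_g (∇^φ ∇^φ - ∇^φ_{∇^M}) W` of a vector field `W` along `φ`. -/
noncomputable def roughLaplacian {k n : ℕ} (g : (Fin k → ℝ) → Matrix (Fin k) (Fin k) ℝ)
    (h : (Fin n → ℝ) → Matrix (Fin n) (Fin n) ℝ) (φ : (Fin k → ℝ) → (Fin n → ℝ))
    (W : (Fin k → ℝ) → (Fin n → ℝ)) (p : Fin k → ℝ) : Fin n → ℝ :=
  fun a => ∑ i, ∑ j, (g p)⁻¹ i j *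
    (covDeriv h φ i (covDeriv h φ j W) p a
      - ∑ l, christoffel g l i j p * covDeriv h φ l W p a)

/-- The trace `Trace_g R^N(dφ, W) dφ`. -/
noncomputable def curvatureTrace {k n : ℕ} (g : (Fin k → ℝ) → Matrix (Fin k) (Fin k) ℝ)
    (h : (Fin n → ℝ) → Matrix (Fin n) (Fin n) ℝ) (φ : (Fin k → ℝ) → (Fin n → ℝ))
    (W : (Fin k → ℝ) → (Fin n → ℝ)) (p : Fin k → ℝ) : Fin n → ℝ :=
  fun a => ∑ i, ∑ j, (g p)⁻¹ i j * ∑ b, ∑ c, ∑ d, curvature h a b c d (φ p) *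
    pd i (fun q => φ q c) p * W p d * pd j (fun q => φ q b) p

/-- The bitension field
`τ₂(φ) = Trace_g (∇^φ ∇^φ - ∇^φ_{∇^M}) τ(φ) - Trace_g R^N(dφ, τ(φ)) dφ`. -/
noncomputable def bitension {k n : ℕ} (g : (Fin k → ℝ) → Matrix (Fin k) (Fin k) ℝ)
    (h : (Fin n → ℝ) → Matrix (Fin n) (Fin n) ℝ) (φ : (Fin k → ℝ) → (Fin n → ℝ))
    (p : Fin k → ℝ) : Fin n → ℝ :=
  fun a => roughLaplacian g h φ (tension g h φ) p a - curvatureTrace g h φ (tension g h φ) p a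

/-- `φ : (U, g) → (N, h)` is harmonic: its tension field vanishes identically. -/
def IsHarmonicOn {k n : ℕ} (g : (Fin k → ℝ) → Matrix (Fin k) (Fin k) ℝ)
    (h : (Fin n → ℝ) → Matrix (Fin n) (Fin n) ℝ) (φ : (Fin k → ℝ) → (Fin n → ℝ))
    (U : Set (Fin k → ℝ)) : Prop :=
  ∀ p ∈ U, tension g h φ p = 0

/-- `φ : (U, g) → (N, h)` is biharmonic: its bitension field vanishes identically. -/
def IsBiharmonicOn {k n : ℕ} (g : (Fin k → ℝ) → Matrix (Fin k) (Fin k) ℝ)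
    (h : (Fin n → ℝ) → Matrix (Fin n) (Fin n) ℝ) (φ : (Fin k → ℝ) → (Fin n → ℝ))
    (U : Set (Fin k → ℝ)) : Prop :=
  ∀ p ∈ U, bitension g h φ p = 0

/-- Proper biharmonic maps: biharmonic maps that are not harmonic. -/
def IsProperBiharmonicOn {k n : ℕ} (g : (Fin k → ℝ) → Matrix (Fin k) (Fin k) ℝ)
    (h : (Fin n → ℝ) → Matrix (Fin n) (Fin n) ℝ) (φ : (Fin k → ℝ) → (Fin n → ℝ))
    (U : Set (Fin k → ℝ)) : Prop :=
  IsBiharmonicOn g h φ U ∧ ¬ IsHarmonicOn g h φ U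

/-! ### Bianchi-Cartan-Vranceanu spaces and their Hopf cylinders -/

/-- The function `F = 1 + m (x² + y²)`. -/
def factor (m x y : ℝ) : ℝ := 1 + m * (x ^ 2 + y ^ 2)

/-- The orthonormal coframe of the BCV space `M³(m, l)`; its rows are
`dx / F`, `dy / F` and `dz + (l / 2) (y dx - x dy) / F`. -/
noncomputable def bcvCoframe (m l : ℝ) (p : Fin 3 → ℝ) : Matrix (Fin 3) (Fin 3) ℝ :=
  !![1 / factor m (p 0) (p 1), 0, 0;
     0, 1 / factor m (p 0) (p 1), 0;
     (l / 2) * (p 1 / factor m (p 0) (p 1)), -((l / 2) * (p 0 / factor m (p 0) (p 1))), 1]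

/-- The metric `(dx² + dy²) / F² + (dz + (l / 2) (y dx - x dy) / F)²` of the BCV space
`M³(m, l)`, which lives on the set of all `(x, y, z)` with `F > 0`. -/
noncomputable def bcvMetric (m l : ℝ) (p : Fin 3 → ℝ) : Matrix (Fin 3) (Fin 3) ℝ :=
  (bcvCoframe m l p)ᵀ * bcvCoframe m l p

/-- `γ = (x, y) : I → B` is a smooth curve parametrized by arclength on an open interval `I`,
where `B` is the set `F > 0` of the plane with the metric `(dx² + dy²) / F²`. -/
structure IsBaseCurve (m : ℝ) (I : Set ℝ) (x y : ℝ → ℝ) : Prop where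
  isOpen : IsOpen I
  ordConnected : I.OrdConnected
  smooth_x : ContDiffOn ℝ ∞ x I
  smooth_y : ContDiffOn ℝ ∞ y I
  mem_base : ∀ s ∈ I, 0 < factor m (x s) (y s)
  unit_speed : ∀ s ∈ I,
    (deriv x s ^ 2 + deriv y s ^ 2) / factor m (x s) (y s) ^ 2 = 1

/-- The Hopf cylinder `φ(s, z) = (γ(s), z)` over `γ = (x, y)`, that is, the preimage of `γ` under
the Riemannian submersion `π(x, y, z) = (x, y)`. -/
def hopfCylinder (x y : ℝ → ℝ) (p : Fin 2 → ℝ) : Fin 3 → ℝ :=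
  ![x (p 0), y (p 0), p 1]

/-- The data `(I, γ = (x, y), U, f)` describe a proper biharmonic conformal immersion
`φ : (U, f⁻¹ φ^* h) → M³(m, l)` of (the open piece `U` of) the Hopf cylinder over `γ : I → B`;
the whole cylinder is the case `U = I × ℝ`.  The conformal factor `f^(1/2)` is an arbitrary
positive smooth function, and may be constant. -/
structure IsProperBiharmonicConformalHopfCylinder (m l : ℝ) (I : Set ℝ) (x y : ℝ → ℝ)
    (U : Set (Fin 2 → ℝ)) (f : (Fin 2 → ℝ) → ℝ) : Prop where
  baseCurve : IsBaseCurve m I x y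
  isOpen : IsOpen U
  subset : U ⊆ {p | p 0 ∈ I}
  smooth : ContDiffOn ℝ ∞ f U
  pos : ∀ p ∈ U, 0 < f p
  properBiharmonic : IsProperBiharmonicOn
    (fun p => (f p)⁻¹ • pullbackMetric (bcvMetric m l) (hopfCylinder x y) p)
    (bcvMetric m l) (hopfCylinder x y) U

/-- There is a proper biharmonic conformal immersion of a Hopf cylinder into `M³(m, l)`. -/
def AdmitsProperBiharmonicConformalHopfCylinder (m l : ℝ) : Prop :=
  ∃ (I : Set ℝ) (x y : ℝ → ℝ) (U : Set (Fin 2 → ℝ)) (f : (Fin 2 → ℝ) → ℝ),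
    IsProperBiharmonicConformalHopfCylinder m l I x y U f

/-! ### The model spaces among the BCV spaces

The base surface has constant Gauss curvature `4 m`, and the horizontal distribution has constant
bundle curvature, proportional to `l`; the following seven cases exhaust the family. -/

/-- `M³(m, l)` is (an open part of) `S² × ℝ`: the base is a sphere, and the metric a product. -/
def IsS2R (m l : ℝ) : Prop := 0 < m ∧ l = 0

/-- `M³(m, l)` is `H² × ℝ`: the base is a hyperbolic plane, and the metric a product. -/
def IsH2R (m l : ℝ) : Prop := m < 0 ∧ l = 0

/-- `M³(m, l)` is Euclidean space `ℝ³`. -/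
def IsR3 (m l : ℝ) : Prop := m = 0 ∧ l = 0

/-- `M³(m, l)` is locally a round sphere `S³`; its sectional curvature is `m`. -/
def IsS3 (m l : ℝ) : Prop := 0 < m ∧ l ^ 2 = 4 * m

/-- `M³(m, l)` is locally `SU(2)` with a left-invariant metric that is not round. -/
def IsSU2 (m l : ℝ) : Prop := 0 < m ∧ l ≠ 0 ∧ l ^ 2 ≠ 4 * m

/-- `M³(m, l)` is the universal cover of `SL(2, ℝ)` with a left-invariant metric. -/
def IsSL2 (m l : ℝ) : Prop := m < 0 ∧ l ≠ 0

/-- `M³(m, l)` is the Heisenberg group `Nil` with a left-invariant metric. -/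
def IsNil (m l : ℝ) : Prop := m = 0 ∧ l ≠ 0

end BCV

/-! Along the cylinder use the orthonormal frame T, N (horizontal lifts of the unit tangent and
normal of γ) and E₃ = ∂_z. On the surface T is the field X = ∂_s - a ∂_z, where a depends on s
alone, so X commutes with Z = ∂_z. The tension field is w N with w = f κ, where κ is the geodesic
curvature of γ (`tension_hopfCylinder`). A surface being two-dimensional, f otherwise enters the
bitension field only as an overall factor, so it survives only through w. By `roughLaplacian_normal`
and `curvatureTrace_normal`, τ₂ = 0 reads T: -2κ Xw - κ' w + l Zw = 0, N: X²w + Z²w = (κ² + l² - 4m)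
w, E₃: l Xw = 0.

Let l ≠ 0. Then Xw = 0 and Zw = κ' w / l. Since X and Z commute, κ'' w = 0, and the normal equation
becomes κ'² w = l² (κ² + l² - 4m) w. Non-harmonicity gives a point with w ≠ 0, hence κ ≠ 0 there.
Cancelling w near that point and differentiating gives κκ' = 0, so κ' = 0 and κ² = 4m - l² > 0. This
is `sq_lt_of_admits`: l² < 4m. It excludes m ≤ 0 and l² = 4m, which leaves only SU(2) among the
spaces with l ≠ 0. The three spaces with l = 0 are all on the permitted list. -/

namespace BCV

/-! ### Partial derivatives -/

section PartialDerivatives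

variable {n : ℕ} {u v : (Fin n → ℝ) → ℝ} {p : Fin n → ℝ}

theorem pd_congr (i : Fin n) (h : u =ᶠ[nhds p] v) : pd i u p = pd i v p := by
  unfold pd
  rw [h.fderiv_eq]

theorem pd_add (i : Fin n) (hu : DifferentiableAt ℝ u p) (hv : DifferentiableAt ℝ v p) :
    pd i (fun q => u q + v q) p = pd i u p + pd i v p := by
  unfold pd
  rw [fderiv_fun_add hu hv]
  rfl

theorem pd_sub (i : Fin n) (hu : DifferentiableAt ℝ u p) (hv : DifferentiableAt ℝ v p) :
    pd i (fun q => u q - v q) p = pd i u p - pd i v p := by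
  unfold pd
  rw [fderiv_fun_sub hu hv]
  rfl

theorem pd_neg (i : Fin n) : pd i (fun q => -u q) p = -pd i u p := by
  unfold pd
  rw [fderiv_fun_neg]
  rfl

theorem pd_mul (i : Fin n) (hu : DifferentiableAt ℝ u p) (hv : DifferentiableAt ℝ v p) :
    pd i (fun q => u q * v q) p = u p * pd i v p + v p * pd i u p := by
  unfold pd
  rw [fderiv_fun_mul hu hv]
  rfl

theorem pd_pow_two (i : Fin n) (hu : DifferentiableAt ℝ u p) :
    pd i (fun q => u q ^ 2) p = 2 * u p * pd i u p := by
  simp only [pow_two]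
  rw [pd_mul i hu hu]
  ring

theorem pd_inv (i : Fin n) (hu : DifferentiableAt ℝ u p) (h : u p ≠ 0) :
    pd i (fun q => (u q)⁻¹) p = -pd i u p * ((u p)⁻¹) ^ 2 := by
  unfold pd
  have h1 := ((hasDerivAt_inv h).comp_hasFDerivAt p hu.hasFDerivAt).fderiv
  have h2 : fderiv ℝ (fun q => (u q)⁻¹) p = _ := h1
  rw [h2]
  simp
  ring

theorem pd_const (i : Fin n) (a : ℝ) : pd i (fun _ => a) p = 0 := by
  simp [pd]

theorem pd_coord (i j : Fin n) : pd i (fun q => q j) p = if i = j then 1 else 0 := by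
  unfold pd
  rw [(hasFDerivAt_apply j p).fderiv]
  simp [Pi.single_apply, eq_comm]

theorem pd_comp_coord (i j : Fin n) {g : ℝ → ℝ} {g' : ℝ} (hg : HasDerivAt g g' (p j)) :
    pd i (fun q => g (q j)) p = if i = j then g' else 0 := by
  unfold pd
  have h := hg.comp_hasFDerivAt p (hasFDerivAt_apply (𝕜 := ℝ) j p)
  have h2 : fderiv ℝ (fun q : Fin n → ℝ => g (q j)) p = _ := h.fderiv
  rw [h2]
  simp [Pi.single_apply, eq_comm]

end PartialDerivatives

/-! ### The Levi-Civita connection of a BCV space -/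

/-- The function `1 / F`. -/
noncomputable def invFactor (m : ℝ) (p : Fin 3 → ℝ) : ℝ := (factor m (p 0) (p 1))⁻¹

theorem differentiable_factor (m : ℝ) :
    Differentiable ℝ (fun p : Fin 3 → ℝ => factor m (p 0) (p 1)) := by
  unfold factor
  fun_prop

theorem differentiableAt_invFactor {m : ℝ} {p : Fin 3 → ℝ} (h : factor m (p 0) (p 1) ≠ 0) :
    DifferentiableAt ℝ (invFactor m) p :=
  ((differentiable_factor m) p).fun_inv h

theorem pd_invFactor {m : ℝ} {p : Fin 3 → ℝ} (h : factor m (p 0) (p 1) ≠ 0) (i : Fin 3) :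
    pd i (invFactor m) p
      = ![-2 * m * p 0 * invFactor m p ^ 2, -2 * m * p 1 * invFactor m p ^ 2, 0] i := by
  have h1 := pd_inv i ((differentiable_factor m) p) h
  have h2 : pd i (invFactor m) p = _ := h1
  rw [h2]
  unfold invFactor
  have h3 : pd i (fun q : Fin 3 → ℝ => factor m (q 0) (q 1)) p
      = ![2 * m * p 0, 2 * m * p 1, 0] i := by
    unfold factor
    rw [pd_add i (by fun_prop) (by fun_prop), pd_mul i (by fun_prop) (by fun_prop),
      pd_add i (by fun_prop) (by fun_prop), pd_pow_two i (by fun_prop),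
      pd_pow_two i (by fun_prop)]
    simp only [pd_const, pd_coord]
    fin_cases i <;> simp <;> ring
  rw [h3]
  fin_cases i <;> simp

/-- The function `(α x + β y) / F`. -/
noncomputable def linOverFactor (m α β : ℝ) (p : Fin 3 → ℝ) : ℝ :=
  invFactor m p * (α * p 0 + β * p 1)

/-- The function `(A x² + B x y + C y² + D) / F²`. -/
noncomputable def quadOverFactor (m A B C D : ℝ) (p : Fin 3 → ℝ) : ℝ :=
  invFactor m p ^ 2 * (A * p 0 ^ 2 + B * (p 0 * p 1) + C * p 1 ^ 2 + D)

theorem pd_linOverFactor {m : ℝ} {p : Fin 3 → ℝ} (h : factor m (p 0) (p 1) ≠ 0) (α β : ℝ)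
    (i : Fin 3) :
    pd i (linOverFactor m α β) p =
      ![invFactor m p * α - 2 * m * p 0 * invFactor m p ^ 2 * (α * p 0 + β * p 1),
        invFactor m p * β - 2 * m * p 1 * invFactor m p ^ 2 * (α * p 0 + β * p 1), 0] i := by
  have hr := differentiableAt_invFactor h
  unfold linOverFactor
  rw [pd_mul i hr (by fun_prop), pd_invFactor h, pd_add i (by fun_prop) (by fun_prop),
    pd_mul i (by fun_prop) (by fun_prop), pd_mul i (by fun_prop) (by fun_prop)]
  simp only [pd_const, pd_coord]
  fin_cases i <;> simp <;> ring

theorem pd_quadOverFactor {m : ℝ} {p : Fin 3 → ℝ} (h : factor m (p 0) (p 1) ≠ 0)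
    (A B C D : ℝ) (i : Fin 3) :
    pd i (quadOverFactor m A B C D) p =
      ![invFactor m p ^ 2 * (2 * A * p 0 + B * p 1) - 4 * m * p 0 * invFactor m p ^ 3 *
          (A * p 0 ^ 2 + B * (p 0 * p 1) + C * p 1 ^ 2 + D),
        invFactor m p ^ 2 * (B * p 0 + 2 * C * p 1) - 4 * m * p 1 * invFactor m p ^ 3 *
          (A * p 0 ^ 2 + B * (p 0 * p 1) + C * p 1 ^ 2 + D), 0] i := by
  have hr := differentiableAt_invFactor h
  unfold quadOverFactor
  rw [pd_mul i (by fun_prop) (by fun_prop), pd_pow_two i hr, pd_invFactor h,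
    pd_add i (by fun_prop) (by fun_prop), pd_add i (by fun_prop) (by fun_prop),
    pd_add i (by fun_prop) (by fun_prop),
    pd_mul i (by fun_prop) (by fun_prop), pd_mul i (by fun_prop) (by fun_prop),
    pd_mul i (by fun_prop) (by fun_prop), pd_mul i (by fun_prop) (by fun_prop),
    pd_pow_two i (by fun_prop), pd_pow_two i (by fun_prop)]
  simp only [pd_const, pd_coord]
  fin_cases i <;> simp <;> ring

/-- The components of the BCV metric. -/
noncomputable def bcvMetricComponent (m l : ℝ) : Fin 3 → Fin 3 → (Fin 3 → ℝ) → ℝ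
  | 0, 0 => quadOverFactor m 0 0 (l ^ 2 / 4) 1
  | 0, 1 | 1, 0 => quadOverFactor m 0 (-(l ^ 2 / 4)) 0 0
  | 1, 1 => quadOverFactor m (l ^ 2 / 4) 0 0 1
  | 0, 2 | 2, 0 => linOverFactor m 0 (l / 2)
  | 1, 2 | 2, 1 => linOverFactor m (-(l / 2)) 0
  | 2, 2 => fun _ => 1

/-- The Christoffel symbols `Γᵏᵢⱼ` of a BCV space, as `bcvChristoffel m l k i j`. -/
noncomputable def bcvChristoffel (m l : ℝ) : Fin 3 → Fin 3 → Fin 3 → (Fin 3 → ℝ) → ℝ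
  | 0, 0, 0 => linOverFactor m (-(2 * m)) 0
  | 0, 0, 1 | 0, 1, 0 => linOverFactor m 0 (l ^ 2 / 4 - 2 * m)
  | 0, 1, 1 => linOverFactor m (2 * m - l ^ 2 / 2) 0
  | 0, 1, 2 | 0, 2, 1 => fun _ => l / 2
  | 1, 0, 0 => linOverFactor m 0 (2 * m - l ^ 2 / 2)
  | 1, 0, 1 | 1, 1, 0 => linOverFactor m (l ^ 2 / 4 - 2 * m) 0
  | 1, 1, 1 => linOverFactor m 0 (-(2 * m))
  | 1, 0, 2 | 1, 2, 0 => fun _ => -(l / 2)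
  | 2, 0, 0 => quadOverFactor m 0 (l * (m - l ^ 2 / 4)) 0 0
  | 2, 0, 1 | 2, 1, 0 =>
      quadOverFactor m (-(l * (m - l ^ 2 / 4) / 2)) 0 (l * (m - l ^ 2 / 4) / 2) 0
  | 2, 1, 1 => quadOverFactor m 0 (-(l * (m - l ^ 2 / 4))) 0 0
  | 2, 0, 2 | 2, 2, 0 => linOverFactor m (-(l ^ 2 / 4)) 0
  | 2, 1, 2 | 2, 2, 1 => linOverFactor m 0 (-(l ^ 2 / 4))
  | 0, 0, 2 | 0, 2, 0 | 0, 2, 2 | 1, 1, 2 | 1, 2, 1 | 1, 2, 2 | 2, 2, 2 => fun _ => 0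

theorem forall_fin_three {P : Fin 3 → Prop} (h0 : P 0) (h1 : P 1) (h2 : P 2) (i : Fin 3) :
    P i := by
  fin_cases i
  exacts [h0, h1, h2]

theorem bcvMetric_apply (m l : ℝ) (p : Fin 3 → ℝ) (i j : Fin 3) :
    bcvMetric m l p i j = bcvMetricComponent m l i j p := by
  revert i j
  refine forall_fin_three (forall_fin_three ?_ ?_ ?_) (forall_fin_three ?_ ?_ ?_)
    (forall_fin_three ?_ ?_ ?_) <;>
    simp [bcvMetric, bcvCoframe, Matrix.mul_apply, Fin.sum_univ_three, div_eq_mul_inv,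
      bcvMetricComponent, linOverFactor, quadOverFactor, invFactor] <;> ring

/-- The inverse metric is ∑ Eᵢ ⊗ Eᵢ over the dual frame E₁ = F ∂ₓ - (l/2) y ∂_z, E₂ = F ∂_y + (l/2)
x ∂_z, E₃ = ∂_z. -/
theorem bcvMetric_inv {m l : ℝ} {p : Fin 3 → ℝ} (h : factor m (p 0) (p 1) ≠ 0) :
    (bcvMetric m l p)⁻¹ =
      !![factor m (p 0) (p 1) ^ 2, 0, -(l / 2) * p 1 * factor m (p 0) (p 1);
        0, factor m (p 0) (p 1) ^ 2, l / 2 * p 0 * factor m (p 0) (p 1);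
        -(l / 2) * p 1 * factor m (p 0) (p 1), l / 2 * p 0 * factor m (p 0) (p 1),
          1 + l ^ 2 / 4 * (p 0 ^ 2 + p 1 ^ 2)] := by
  apply Matrix.inv_eq_left_inv
  ext i j
  rw [Matrix.mul_apply]
  simp only [bcvMetric_apply, Fin.sum_univ_three]
  revert i j
  refine forall_fin_three (forall_fin_three ?_ ?_ ?_) (forall_fin_three ?_ ?_ ?_)
    (forall_fin_three ?_ ?_ ?_) <;>
    simp [bcvMetricComponent, linOverFactor, quadOverFactor, invFactor] <;> field_simp <;> ring

theorem christoffel_bcvMetric {m l : ℝ} {p : Fin 3 → ℝ} (h : factor m (p 0) (p 1) ≠ 0)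
    (k i j : Fin 3) : christoffel (bcvMetric m l) k i j p = bcvChristoffel m l k i j p := by
  have hr : invFactor m p = (factor m (p 0) (p 1))⁻¹ := rfl
  have hF : factor m (p 0) (p 1) = 1 + m * (p 0 ^ 2 + p 1 ^ 2) := rfl
  unfold christoffel
  simp only [bcvMetric_inv h, Fin.sum_univ_three, bcvMetric_apply]
  revert k i j
  refine forall_fin_three
    (forall_fin_three (forall_fin_three ?_ ?_ ?_) (forall_fin_three ?_ ?_ ?_)
      (forall_fin_three ?_ ?_ ?_))
    (forall_fin_three (forall_fin_three ?_ ?_ ?_) (forall_fin_three ?_ ?_ ?_)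
      (forall_fin_three ?_ ?_ ?_))
    (forall_fin_three (forall_fin_three ?_ ?_ ?_) (forall_fin_three ?_ ?_ ?_)
      (forall_fin_three ?_ ?_ ?_)) <;>
    simp only [bcvMetricComponent, bcvChristoffel, pd_linOverFactor h, pd_quadOverFactor h,
      pd_const] <;>
    simp only [linOverFactor, quadOverFactor, Matrix.of_apply, Matrix.cons_val] <;>
    (try rw [hr]) <;> field_simp <;> (try rw [hF]) <;> ring

/-! ### Curvature of a BCV space -/

theorem eventually_factor_ne_zero {m : ℝ} {p : Fin 3 → ℝ} (h : factor m (p 0) (p 1) ≠ 0) :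
    ∀ᶠ q : Fin 3 → ℝ in nhds p, factor m (q 0) (q 1) ≠ 0 :=
  (differentiable_factor m).continuous.continuousAt.eventually_ne h

/-- Curvature differentiates the Christoffel symbols, so their table is needed near p; it is
available there because F ≠ 0 is an open condition. -/
theorem curvature_bcvMetric {m l : ℝ} {p : Fin 3 → ℝ} (h : factor m (p 0) (p 1) ≠ 0)
    (a b c d : Fin 3) :
    curvature (bcvMetric m l) a b c d p =
      pd c (bcvChristoffel m l a d b) p - pd d (bcvChristoffel m l a c b) p
        + ∑ e, (bcvChristoffel m l a c e p * bcvChristoffel m l e d b p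
          - bcvChristoffel m l a d e p * bcvChristoffel m l e c b p) := by
  have hev (k i j : Fin 3) :
      christoffel (bcvMetric m l) k i j =ᶠ[nhds p] bcvChristoffel m l k i j :=
    (eventually_factor_ne_zero h).mono fun q hq => christoffel_bcvMetric hq k i j
  unfold curvature
  rw [pd_congr c (hev a d b), pd_congr d (hev a c b)]
  simp only [christoffel_bcvMetric h]

/-- The coordinates of the horizontal vector `u E₁ + v E₂`, where
`E₁ = F ∂ₓ - (l / 2) y ∂_z` and `E₂ = F ∂_y + (l / 2) x ∂_z`. -/
noncomputable def horizontal (m l x y u v : ℝ) : Fin 3 → ℝ :=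
  ![factor m x y * u, factor m x y * v, -(l / 2) * (y * u - x * v)]

/-- The coordinates of the vertical unit vector `E₃ = ∂_z`. -/
def vertical : Fin 3 → ℝ := ![0, 0, 1]

-- Horizontal planes have sectional curvature 4m - 3l²/4, the base curvature 4m lowered by O'Neill's
-- term. Leaving (u, v) of arbitrary length makes this a rational identity in the coordinates.
set_option maxHeartbeats 1000000 in
theorem curvature_bcvMetric_horizontal {m l : ℝ} {p : Fin 3 → ℝ}
    (h : factor m (p 0) (p 1) ≠ 0) (u v : ℝ) (a : Fin 3) :
    ∑ b, ∑ c, ∑ d, curvature (bcvMetric m l) a b c d p * (horizontal m l (p 0) (p 1) u v c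
        * horizontal m l (p 0) (p 1) (-v) u d * horizontal m l (p 0) (p 1) u v b)
      = -(4 * m - 3 * l ^ 2 / 4) * (u ^ 2 + v ^ 2) * horizontal m l (p 0) (p 1) (-v) u a := by
  have hr : invFactor m p = (factor m (p 0) (p 1))⁻¹ := rfl
  have hF : factor m (p 0) (p 1) = 1 + m * (p 0 ^ 2 + p 1 ^ 2) := rfl
  simp only [curvature_bcvMetric h, Fin.sum_univ_three]
  revert a
  refine forall_fin_three ?_ ?_ ?_ <;>
    simp only [bcvChristoffel, pd_linOverFactor h, pd_quadOverFactor h, pd_const] <;>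
    simp only [linOverFactor, quadOverFactor, Matrix.cons_val, horizontal] <;>
    rw [hr] <;> field_simp <;> rw [hF] <;> ring

/-- Planes containing ∂_z have sectional curvature l²/4. -/
theorem curvature_bcvMetric_vertical {m l : ℝ} {p : Fin 3 → ℝ}
    (h : factor m (p 0) (p 1) ≠ 0) (u v : ℝ) (a : Fin 3) :
    ∑ b, ∑ c, ∑ d, curvature (bcvMetric m l) a b c d p * (vertical c
        * horizontal m l (p 0) (p 1) u v d * vertical b)
      = -(l ^ 2 / 4) * horizontal m l (p 0) (p 1) u v a := by
  have hr : invFactor m p = (factor m (p 0) (p 1))⁻¹ := rfl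
  simp only [curvature_bcvMetric h, Fin.sum_univ_three]
  revert a
  refine forall_fin_three ?_ ?_ ?_ <;>
    simp only [bcvChristoffel, pd_linOverFactor h, pd_quadOverFactor h, pd_const] <;>
    simp only [linOverFactor, quadOverFactor, Matrix.cons_val, horizontal, vertical,
      mul_zero, zero_mul, add_zero, zero_add, sub_zero, mul_one, one_mul, sub_self] <;>
    (try rw [hr]) <;> field_simp <;> ring

/-! ### The adapted frame of a Hopf cylinder -/

/-- The unit tangent of the base curve `(x, y)` is `u E₁ + v E₂`, and `k` is the rate of
rotation of `(u, v)`. -/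
structure IsFramedCurve (m : ℝ) (I : Set ℝ) (x y u v k : ℝ → ℝ) : Prop where
  isOpen : IsOpen I
  smooth_x : ∀ s ∈ I, ContDiffAt ℝ ∞ x s
  smooth_y : ∀ s ∈ I, ContDiffAt ℝ ∞ y s
  smooth_u : ∀ s ∈ I, ContDiffAt ℝ ∞ u s
  smooth_v : ∀ s ∈ I, ContDiffAt ℝ ∞ v s
  smooth_k : ∀ s ∈ I, ContDiffAt ℝ ∞ k s
  factor_pos : ∀ s ∈ I, 0 < factor m (x s) (y s)
  unit : ∀ s ∈ I, u s ^ 2 + v s ^ 2 = 1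
  deriv_x : ∀ s ∈ I, HasDerivAt x (factor m (x s) (y s) * u s) s
  deriv_y : ∀ s ∈ I, HasDerivAt y (factor m (x s) (y s) * v s) s
  deriv_u : ∀ s ∈ I, HasDerivAt u (-(k s * v s)) s
  deriv_v : ∀ s ∈ I, HasDerivAt v (k s * u s) s

/-- The coordinates of `α T + β N + γ ∂_z`, where `T` and `N` are the horizontal lifts of the unit
tangent and the unit normal of the base curve. -/
noncomputable def frameVector (m l x y u v α β γ : ℝ) : Fin 3 → ℝ :=
  ![factor m x y * (α * u - β * v), factor m x y * (α * v + β * u),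
    -(l / 2) * (y * (α * u - β * v) - x * (α * v + β * u)) + γ]

/-- The vector field `α T + β N + γ ∂_z` along a Hopf cylinder. -/
noncomputable def frameField (m l : ℝ) (x y u v : ℝ → ℝ) (α β γ : (Fin 2 → ℝ) → ℝ)
    (q : Fin 2 → ℝ) : Fin 3 → ℝ :=
  frameVector m l (x (q 0)) (y (q 0)) (u (q 0)) (v (q 0)) (α q) (β q) (γ q)

/-- The function `a` with `∂_s φ = T + a ∂_z`. -/
noncomputable def slope (l : ℝ) (x y u v : ℝ → ℝ) (s : ℝ) : ℝ :=
  l / 2 * (y s * u s - x s * v s)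

/-- The geodesic curvature of the base curve. -/
noncomputable def geodesicCurvature (m : ℝ) (x y u v k : ℝ → ℝ) (s : ℝ) : ℝ :=
  k s + 2 * m * (y s * u s - x s * v s)

theorem covDeriv_congr {k n : ℕ} {h : (Fin n → ℝ) → Matrix (Fin n) (Fin n) ℝ}
    {φ : (Fin k → ℝ) → (Fin n → ℝ)} {W W' : (Fin k → ℝ) → (Fin n → ℝ)} {p : Fin k → ℝ}
    (i : Fin k) (hW : W =ᶠ[nhds p] W') : covDeriv h φ i W p = covDeriv h φ i W' p := by
  funext a
  unfold covDeriv
  rw [pd_congr i (hW.mono fun q hq => congrFun hq a), hW.self_of_nhds]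

theorem frameVector_eq_zero {m l x y u v α β γ : ℝ} (hF : factor m x y ≠ 0)
    (h1 : u ^ 2 + v ^ 2 = 1) (h : frameVector m l x y u v α β γ = 0) :
    α = 0 ∧ β = 0 ∧ γ = 0 := by
  have e0 := congrFun h 0
  have e1 := congrFun h 1
  have e2 := congrFun h 2
  simp only [frameVector, Matrix.cons_val, Pi.zero_apply] at e0 e1 e2
  have e0' := (mul_eq_zero.mp e0).resolve_left hF
  have e1' := (mul_eq_zero.mp e1).resolve_left hF
  rw [e0', e1'] at e2
  refine ⟨?_, ?_, ?_⟩
  · linear_combination u * e0' + v * e1' - α * h1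
  · linear_combination u * e1' - v * e0' - β * h1
  · linear_combination e2

namespace IsFramedCurve

variable {m l : ℝ} {I : Set ℝ} {x y u v k : ℝ → ℝ} {p : Fin 2 → ℝ}

theorem eventually_mem (hc : IsFramedCurve m I x y u v k) (hp : p 0 ∈ I) :
    ∀ᶠ q : Fin 2 → ℝ in nhds p, q 0 ∈ I :=
  (continuous_apply 0).continuousAt.eventually (hc.isOpen.mem_nhds hp)

theorem hasDerivAt_slope (hc : IsFramedCurve m I x y u v k) {s : ℝ} (hs : s ∈ I) :
    HasDerivAt (slope l x y u v) (-(l / 2) * k s * (x s * u s + y s * v s)) s := by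
  have h := (((hc.deriv_y s hs).mul (hc.deriv_u s hs)).sub
    ((hc.deriv_x s hs).mul (hc.deriv_v s hs))).const_mul (l / 2)
  refine h.congr_deriv ?_
  ring

theorem contDiffAt_geodesicCurvature (hc : IsFramedCurve m I x y u v k) {s : ℝ} (hs : s ∈ I) :
    ContDiffAt ℝ ∞ (geodesicCurvature m x y u v k) s := by
  have := hc.smooth_x s hs
  have := hc.smooth_y s hs
  have := hc.smooth_u s hs
  have := hc.smooth_v s hs
  have := hc.smooth_k s hs
  unfold geodesicCurvature
  fun_prop

theorem pd_hopfCylinder (hc : IsFramedCurve m I x y u v k) (hp : p 0 ∈ I) (i : Fin 2)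
    (b : Fin 3) :
    pd i (fun q => hopfCylinder x y q b) p =
      if i = 0 then
        ![factor m (x (p 0)) (y (p 0)) * u (p 0), factor m (x (p 0)) (y (p 0)) * v (p 0), 0] b
      else ![0, 0, 1] b := by
  revert b
  refine forall_fin_three ?_ ?_ ?_ <;> simp only [hopfCylinder, Matrix.cons_val]
  · rw [pd_comp_coord i 0 (hc.deriv_x _ hp)]
  · rw [pd_comp_coord i 0 (hc.deriv_y _ hp)]
  · rw [pd_coord]
    fin_cases i <;> simp

theorem pd_hopfCylinder_zero (hc : IsFramedCurve m I x y u v k) (hp : p 0 ∈ I) :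
    (fun b => pd 0 (fun q => hopfCylinder x y q b) p) =
      frameField m l x y u v (fun _ => 1) (fun _ => 0) (fun q => slope l x y u v (q 0)) p := by
  funext b
  rw [hc.pd_hopfCylinder hp, if_pos rfl]
  revert b
  refine forall_fin_three ?_ ?_ ?_ <;>
    simp only [frameField, frameVector, Matrix.cons_val, slope] <;> ring

theorem pd_hopfCylinder_one (hc : IsFramedCurve m I x y u v k) (hp : p 0 ∈ I) :
    (fun b => pd 1 (fun q => hopfCylinder x y q b) p) =
      frameField m l x y u v (fun _ => 0) (fun _ => 0) (fun _ => 1) p := by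
  funext b
  rw [hc.pd_hopfCylinder hp, if_neg (by decide)]
  revert b
  refine forall_fin_three ?_ ?_ ?_ <;>
    simp only [frameField, frameVector, Matrix.cons_val] <;> ring

/-- Product rule: the second summand differentiates the coordinates of T and N, which depend on s
only. Here `F'` is the derivative of F along γ. -/
theorem pd_frameField (hc : IsFramedCurve m I x y u v k) (hp : p 0 ∈ I)
    {α β γ : (Fin 2 → ℝ) → ℝ} (hα : DifferentiableAt ℝ α p) (hβ : DifferentiableAt ℝ β p)
    (hγ : DifferentiableAt ℝ γ p) (i : Fin 2) (b : Fin 3) :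
    pd i (fun q => frameField m l x y u v α β γ q b) p =
      frameField m l x y u v (pd i α) (pd i β) (pd i γ) p b +
      (if i = 0 then
        let F := factor m (x (p 0)) (y (p 0))
        let b₁ := α p * u (p 0) - β p * v (p 0)
        let b₂ := α p * v (p 0) + β p * u (p 0)
        let F' := 2 * m * F * (x (p 0) * u (p 0) + y (p 0) * v (p 0))
        ![F' * b₁ - F * k (p 0) * b₂, F' * b₂ + F * k (p 0) * b₁,
          -(l / 2) * (F * (v (p 0) * b₁ - u (p 0) * b₂) -
            k (p 0) * (y (p 0) * b₂ + x (p 0) * b₁))] b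
      else 0) := by
  have hx := (hc.deriv_x _ hp).differentiableAt
  have hy := (hc.deriv_y _ hp).differentiableAt
  have hu := (hc.deriv_u _ hp).differentiableAt
  have hv := (hc.deriv_v _ hp).differentiableAt
  have ex := pd_comp_coord i 0 (hc.deriv_x _ hp)
  have ey := pd_comp_coord i 0 (hc.deriv_y _ hp)
  have eu := pd_comp_coord i 0 (hc.deriv_u _ hp)
  have ev := pd_comp_coord i 0 (hc.deriv_v _ hp)
  revert b
  refine forall_fin_three ?_ ?_ ?_ <;>
    simp (disch := fun_prop) only [frameField, frameVector, Matrix.cons_val, factor, pd_mul,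
      pd_add, pd_sub, pd_pow_two, pd_const, ex, ey, eu, ev] <;>
    split_ifs <;> ring

/-- Since ∂_s φ = T + a E₃, this encodes ∇_T T = κ N, ∇_T N = -κ T + (l/2) E₃, ∇_T E₃ = ∇_{E₃} T =
-(l/2) N, ∇_{E₃} N = (l/2) T and ∇_{E₃} E₃ = 0. -/
theorem covDeriv_frameField_zero (hc : IsFramedCurve m I x y u v k) (hp : p 0 ∈ I)
    {α β γ : (Fin 2 → ℝ) → ℝ} (hα : DifferentiableAt ℝ α p) (hβ : DifferentiableAt ℝ β p)
    (hγ : DifferentiableAt ℝ γ p) :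
    covDeriv (bcvMetric m l) (hopfCylinder x y) 0 (frameField m l x y u v α β γ) p =
      frameVector m l (x (p 0)) (y (p 0)) (u (p 0)) (v (p 0))
        (pd 0 α p - (geodesicCurvature m x y u v k (p 0)
          - l / 2 * slope l x y u v (p 0)) * β p)
        (pd 0 β p + (geodesicCurvature m x y u v k (p 0)
          - l / 2 * slope l x y u v (p 0)) * α p - l / 2 * γ p)
        (pd 0 γ p + l / 2 * β p) := by
  have hF : factor m (hopfCylinder x y p 0) (hopfCylinder x y p 1) ≠ 0 :=
    (hc.factor_pos _ hp).ne'
  have hF' : factor m (x (p 0)) (y (p 0)) ≠ 0 := (hc.factor_pos _ hp).ne'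
  have hr : invFactor m (hopfCylinder x y p) = (factor m (x (p 0)) (y (p 0)))⁻¹ := rfl
  have hFe : factor m (x (p 0)) (y (p 0)) = 1 + m * (x (p 0) ^ 2 + y (p 0) ^ 2) := rfl
  -- Unit speed is needed only in the E₃ coefficient; writing 1 as u² + v² there leaves identities
  -- for `ring`.
  have h1 : l / 2 * β p = l / 2 * β p * (u (p 0) ^ 2 + v (p 0) ^ 2) := by
    rw [hc.unit _ hp, mul_one]
  rw [h1]
  clear h1
  funext b
  unfold covDeriv
  rw [hc.pd_frameField hp hα hβ hγ, if_pos rfl]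
  simp only [christoffel_bcvMetric hF, hc.pd_hopfCylinder hp, if_pos, Fin.sum_univ_three]
  revert b
  refine forall_fin_three ?_ ?_ ?_ <;>
    simp only [bcvChristoffel, linOverFactor, quadOverFactor, frameField, frameVector, hr] <;>
    simp only [hopfCylinder, Matrix.cons_val, geodesicCurvature, slope] <;> field_simp <;>
    simp only [hFe] <;> ring

theorem covDeriv_frameField_one (hc : IsFramedCurve m I x y u v k) (hp : p 0 ∈ I)
    {α β γ : (Fin 2 → ℝ) → ℝ} (hα : DifferentiableAt ℝ α p) (hβ : DifferentiableAt ℝ β p)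
    (hγ : DifferentiableAt ℝ γ p) :
    covDeriv (bcvMetric m l) (hopfCylinder x y) 1 (frameField m l x y u v α β γ) p =
      frameVector m l (x (p 0)) (y (p 0)) (u (p 0)) (v (p 0))
        (pd 1 α p + l / 2 * β p) (pd 1 β p - l / 2 * α p) (pd 1 γ p) := by
  have hF : factor m (hopfCylinder x y p 0) (hopfCylinder x y p 1) ≠ 0 :=
    (hc.factor_pos _ hp).ne'
  have hF' : factor m (x (p 0)) (y (p 0)) ≠ 0 := (hc.factor_pos _ hp).ne'
  have hr : invFactor m (hopfCylinder x y p) = (factor m (x (p 0)) (y (p 0)))⁻¹ := rfl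
  have h10 : ¬ (1 : Fin 2) = 0 := by decide
  funext b
  unfold covDeriv
  rw [hc.pd_frameField hp hα hβ hγ, if_neg h10]
  simp only [christoffel_bcvMetric hF, hc.pd_hopfCylinder hp, if_neg h10, Fin.sum_univ_three]
  revert b
  refine forall_fin_three ?_ ?_ ?_ <;>
    simp only [bcvChristoffel, linOverFactor, quadOverFactor, frameField, frameVector, hr] <;>
    simp only [hopfCylinder, Matrix.cons_val] <;> field_simp <;> ring

/-! ### The induced metric -/

theorem pullbackMetric_hopfCylinder (hc : IsFramedCurve m I x y u v k) (hp : p 0 ∈ I) :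
    pullbackMetric (bcvMetric m l) (hopfCylinder x y) p =
      !![1 + slope l x y u v (p 0) ^ 2, slope l x y u v (p 0); slope l x y u v (p 0), 1] := by
  have hF' : factor m (x (p 0)) (y (p 0)) ≠ 0 := (hc.factor_pos _ hp).ne'
  have hr : invFactor m (hopfCylinder x y p) = (factor m (x (p 0)) (y (p 0)))⁻¹ := rfl
  have h1 : (1 : ℝ) + slope l x y u v (p 0) ^ 2 =
      u (p 0) ^ 2 + v (p 0) ^ 2 + slope l x y u v (p 0) ^ 2 := by rw [hc.unit _ hp]
  rw [h1]
  clear h1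
  have h10 : ¬ (1 : Fin 2) = 0 := by decide
  ext i j
  unfold pullbackMetric
  simp only [hc.pd_hopfCylinder hp, Matrix.of_apply, bcvMetric_apply, Fin.sum_univ_three]
  fin_cases i <;> fin_cases j <;>
    simp only [Fin.zero_eta, Fin.mk_one, if_pos, if_neg h10, bcvMetricComponent, linOverFactor,
      quadOverFactor, hr] <;>
    simp only [hopfCylinder, Matrix.cons_val, slope] <;> field_simp <;> ring

end IsFramedCurve

/-- The trace of a second derivative on a surface with a metric `f⁻¹ (ds² + (dz + a ds)²)`, where
`a` is a function of `s`. -/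
theorem trace_conformal_hopf {g : (Fin 2 → ℝ) → Matrix (Fin 2) (Fin 2) ℝ}
    {f : (Fin 2 → ℝ) → ℝ} {a : ℝ → ℝ} {a' : ℝ} {p : Fin 2 → ℝ}
    (hg : g =ᶠ[nhds p] fun q => (f q)⁻¹ • !![1 + a (q 0) ^ 2, a (q 0); a (q 0), 1])
    (hf : DifferentiableAt ℝ f p) (hf0 : f p ≠ 0) (ha : HasDerivAt a a' (p 0))
    (Q : Fin 2 → Fin 2 → ℝ) (P : Fin 2 → ℝ) :
    ∑ i, ∑ j, (g p)⁻¹ i j * (Q i j - ∑ l, christoffel g l i j p * P l) =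
      f p * (Q 0 0 - a (p 0) * (Q 0 1 + Q 1 0) + (1 + a (p 0) ^ 2) * Q 1 1 - a' * P 1) := by
  have hinv : (g p)⁻¹ = f p • !![1, -a (p 0); -a (p 0), 1 + a (p 0) ^ 2] := by
    apply Matrix.inv_eq_left_inv
    rw [hg.self_of_nhds]
    ext i j
    fin_cases i <;> fin_cases j <;>
      simp [Matrix.mul_apply, Fin.sum_univ_two] <;> field_simp <;> ring
  have hfi : DifferentiableAt ℝ (fun q => (f q)⁻¹) p := hf.fun_inv hf0
  have had := ha.differentiableAt
  have ea (i : Fin 2) := pd_comp_coord (n := 2) (p := p) i 0 ha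
  have hpd (i j t : Fin 2) : pd t (fun q => g q i j) p =
      pd t (fun q => (f q)⁻¹ * !![1 + a (q 0) ^ 2, a (q 0); a (q 0), 1] i j) p :=
    pd_congr t (hg.mono fun q hq => congrFun (congrFun hq i) j)
  have hpd00 (t : Fin 2) : pd t (fun q => g q 0 0) p =
      (f p)⁻¹ * (2 * a (p 0) * if t = 0 then a' else 0)
        - (1 + a (p 0) ^ 2) * (pd t f p * (f p)⁻¹ ^ 2) := by
    rw [hpd]
    simp (disch := fun_prop) only [Matrix.of_apply, Matrix.cons_val, pd_mul, pd_add, pd_pow_two,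
      pd_const, ea]
    rw [pd_inv t hf hf0]
    ring
  have hpd01 (t : Fin 2) : pd t (fun q => g q 0 1) p =
      (f p)⁻¹ * (if t = 0 then a' else 0) - a (p 0) * (pd t f p * (f p)⁻¹ ^ 2) := by
    rw [hpd]
    simp (disch := fun_prop) only [Matrix.of_apply, Matrix.cons_val, pd_mul, ea]
    rw [pd_inv t hf hf0]
    ring
  have hpd10 (t : Fin 2) : pd t (fun q => g q 1 0) p =
      (f p)⁻¹ * (if t = 0 then a' else 0) - a (p 0) * (pd t f p * (f p)⁻¹ ^ 2) := by
    rw [hpd]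
    simp (disch := fun_prop) only [Matrix.of_apply, Matrix.cons_val, pd_mul, ea]
    rw [pd_inv t hf hf0]
    ring
  have hpd11 (t : Fin 2) : pd t (fun q => g q 1 1) p = -(pd t f p * (f p)⁻¹ ^ 2) := by
    rw [hpd]
    simp only [Matrix.of_apply, Matrix.cons_val, mul_one]
    rw [pd_inv t hf hf0]
    ring
  have h10 : ¬ (1 : Fin 2) = 0 := by decide
  simp only [christoffel, hinv, Fin.sum_univ_two, hpd00, hpd01, hpd10, hpd11, if_pos, if_neg h10,
    Matrix.smul_apply, Matrix.of_apply, Matrix.cons_val, smul_eq_mul]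
  -- The derivatives of f cancel in the contraction of g⁻¹ with the Christoffel symbols because the
  -- surface has dimension two; only the a' term survives.
  field_simp
  ring

theorem contDiffAt_pd {n : ℕ} {w : (Fin n → ℝ) → ℝ} {p : Fin n → ℝ} (i : Fin n)
    (h : ContDiffAt ℝ ∞ w p) : ContDiffAt ℝ ∞ (pd i w) p :=
  (h.fderiv_right (m := ∞) le_rfl).clm_apply contDiffAt_const

/-- Source of the integrability condition that yields κ'' w = 0. -/
theorem pd_comm {n : ℕ} {w : (Fin n → ℝ) → ℝ} {p : Fin n → ℝ} (i j : Fin n)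
    (h : ContDiffAt ℝ ∞ w p) : pd i (pd j w) p = pd j (pd i w) p := by
  have hd : DifferentiableAt ℝ (fderiv ℝ w) p :=
    (h.fderiv_right (m := ∞) le_rfl).differentiableAt (by simp)
  have key (i j : Fin n) : pd i (pd j w) p =
      fderiv ℝ (fderiv ℝ w) p (Pi.single i 1) (Pi.single j 1) := by
    have e := (hd.hasFDerivAt.clm_apply
      (hasFDerivAt_const (Pi.single j (1 : ℝ) : Fin n → ℝ) p)).fderiv
    have e2 : pd i (pd j w) p = _ := congrArg (fun L => L (Pi.single i 1)) e
    rw [e2]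
    simp
  rw [key, key]
  exact (h.isSymmSndFDerivAt (by
    rw [minSmoothness_of_isRCLikeNormedField]
    exact WithTop.coe_le_coe.2 (le_top : (2 : ℕ∞) ≤ ⊤))).eq _ _

/-! ### Tension field and the two terms of the bitension field -/

namespace IsFramedCurve

variable {m l : ℝ} {I : Set ℝ} {x y u v k : ℝ → ℝ} {p : Fin 2 → ℝ}
  {g : (Fin 2 → ℝ) → Matrix (Fin 2) (Fin 2) ℝ} {f w : (Fin 2 → ℝ) → ℝ}

theorem conformalMetric_eventuallyEq (hc : IsFramedCurve m I x y u v k) (hp : p 0 ∈ I) :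
    (fun q => (f q)⁻¹ • pullbackMetric (bcvMetric m l) (hopfCylinder x y) q) =ᶠ[nhds p]
      fun q => (f q)⁻¹ • !![1 + slope l x y u v (q 0) ^ 2, slope l x y u v (q 0);
        slope l x y u v (q 0), 1] :=
  (hc.eventually_mem hp).mono fun q hq => by
    simp only [hc.pullbackMetric_hopfCylinder hq]

/-- For f = 1 the trace is ∇_T T + ∇_{E₃} E₃ = κ N, the surface being flat with commuting
orthonormal fields X, Z. The conformal change multiplies it by f. -/
theorem tension_hopfCylinder (hc : IsFramedCurve m I x y u v k) (hp : p 0 ∈ I)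
    (hf : DifferentiableAt ℝ f p) (hf0 : f p ≠ 0) :
    tension (fun q => (f q)⁻¹ • pullbackMetric (bcvMetric m l) (hopfCylinder x y) q)
        (bcvMetric m l) (hopfCylinder x y) p =
      frameField m l x y u v (fun _ => 0)
        (fun q => f q * geodesicCurvature m x y u v k (q 0)) (fun _ => 0) p := by
  have ha := hc.hasDerivAt_slope (l := l) hp
  have hda : DifferentiableAt ℝ (fun q : Fin 2 → ℝ => slope l x y u v (q 0)) p :=
    ha.differentiableAt.fun_comp' p (differentiableAt_apply (𝕜 := ℝ) 0 p)
  have ea (i : Fin 2) := pd_comp_coord (n := 2) (p := p) i 0 ha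
  have h10 : ¬ (1 : Fin 2) = 0 := by decide
  have e0 : (fun q b => pd 0 (fun r => hopfCylinder x y r b) q) =ᶠ[nhds p] frameField m l x y u v
      (fun _ => 1) (fun _ => 0) (fun q => slope l x y u v (q 0)) :=
    (hc.eventually_mem hp).mono fun q hq => hc.pd_hopfCylinder_zero hq
  have e1 : (fun q b => pd 1 (fun r => hopfCylinder x y r b) q) =ᶠ[nhds p] frameField m l x y u v
      (fun _ => 0) (fun _ => 0) (fun _ => 1) :=
    (hc.eventually_mem hp).mono fun q hq => hc.pd_hopfCylinder_one hq
  have c1 : DifferentiableAt ℝ (fun _ : Fin 2 → ℝ => (1 : ℝ)) p := differentiableAt_const _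
  have c0 : DifferentiableAt ℝ (fun _ : Fin 2 → ℝ => (0 : ℝ)) p := differentiableAt_const _
  funext b
  unfold tension
  rw [trace_conformal_hopf (hc.conformalMetric_eventuallyEq hp) hf hf0 ha
    (fun i j => covDeriv (bcvMetric m l) (hopfCylinder x y) i
      (fun q b => pd j (fun r => hopfCylinder x y r b) q) p b)
    (fun t => pd t (fun q => hopfCylinder x y q b) p)]
  simp only [covDeriv_congr _ e0, covDeriv_congr _ e1, congrFun e1.self_of_nhds b,
    hc.covDeriv_frameField_zero hp c1 c0 hda, hc.covDeriv_frameField_one hp c1 c0 hda,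
    hc.covDeriv_frameField_zero hp c0 c0 c1, hc.covDeriv_frameField_one hp c0 c0 c1, pd_const, ea,
    if_true, if_neg h10]
  revert b
  refine forall_fin_three ?_ ?_ ?_ <;>
    simp only [frameField, frameVector, Matrix.cons_val] <;> ring

/-- Up to the factor f this is (∇_X ∇_X + ∇_Z ∇_Z)(w N), expanded from ∇_X(wN) = Xw N - κ w T +
(l/2) w E₃ and ∇_Z(wN) = Zw N + (l/2) w T. -/
theorem roughLaplacian_normal (hc : IsFramedCurve m I x y u v k) (hp : p 0 ∈ I)
    (hf : DifferentiableAt ℝ f p) (hf0 : f p ≠ 0) (hw : ContDiffAt ℝ ∞ w p)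
    {W : (Fin 2 → ℝ) → (Fin 3 → ℝ)}
    (hW : W =ᶠ[nhds p] frameField m l x y u v (fun _ => 0) w (fun _ => 0)) (b : Fin 3) :
    let a := slope l x y u v (p 0)
    let κ := geodesicCurvature m x y u v k (p 0)
    let a' := -(l / 2) * k (p 0) * (x (p 0) * u (p 0) + y (p 0) * v (p 0))
    let Xw := pd 0 w p - a * pd 1 w p
    roughLaplacian (fun q => (f q)⁻¹ • pullbackMetric (bcvMetric m l) (hopfCylinder x y) q)
        (bcvMetric m l) (hopfCylinder x y) W p b =
      f p * frameVector m l (x (p 0)) (y (p 0)) (u (p 0)) (v (p 0))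
        (-2 * κ * Xw - w p * deriv (geodesicCurvature m x y u v k) (p 0) + l * pd 1 w p)
        (pd 0 (pd 0 w) p - a' * pd 1 w p - a * pd 0 (pd 1 w) p - a * pd 1 (pd 0 w) p
          + (1 + a ^ 2) * pd 1 (pd 1 w) p - w p * (κ ^ 2 + l ^ 2 / 2))
        (l * Xw) b := by
  intro a κ a' Xw
  have ha := hc.hasDerivAt_slope (l := l) hp
  have hκ := ((hc.contDiffAt_geodesicCurvature hp).differentiableAt (by simp)).hasDerivAt
  have had := ha.differentiableAt
  have hκd := hκ.differentiableAt
  have hwd : DifferentiableAt ℝ w p := hw.differentiableAt (by simp)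
  have hw0 : DifferentiableAt ℝ (pd 0 w) p := (contDiffAt_pd 0 hw).differentiableAt (by simp)
  have hw1 : DifferentiableAt ℝ (pd 1 w) p := (contDiffAt_pd 1 hw).differentiableAt (by simp)
  have ea (i : Fin 2) := pd_comp_coord (n := 2) (p := p) i 0 ha
  have eκ (i : Fin 2) := pd_comp_coord (n := 2) (p := p) i 0 hκ
  have h10 : ¬ (1 : Fin 2) = 0 := by decide
  have c0 (q : Fin 2 → ℝ) : DifferentiableAt ℝ (fun _ : Fin 2 → ℝ => (0 : ℝ)) q :=
    differentiableAt_const _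
  -- First covariant derivatives are differentiated again, so their formulas are needed on a
  -- neighbourhood of p.
  have hev : ∀ᶠ q in nhds p, q 0 ∈ I ∧ DifferentiableAt ℝ w q ∧
      W =ᶠ[nhds q] frameField m l x y u v (fun _ => 0) w (fun _ => 0) := by
    have h2 : ∀ᶠ q in nhds p, DifferentiableAt ℝ w q :=
      ((hw.of_le (m := 1) (by simp)).eventually (by simp)).mono
        fun q hq => hq.differentiableAt (by simp)
    filter_upwards [hc.eventually_mem hp, h2, hW.eventuallyEq_nhds] with q h1 h2 h3
    exact ⟨h1, h2, h3⟩
  have e0 : covDeriv (bcvMetric m l) (hopfCylinder x y) 0 W =ᶠ[nhds p] frameField m l x y u v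
      (fun q => -((geodesicCurvature m x y u v k (q 0) - l / 2 * slope l x y u v (q 0)) * w q))
      (pd 0 w) (fun q => l / 2 * w q) := by
    filter_upwards [hev] with q ⟨h1, h2, h3⟩
    rw [covDeriv_congr 0 h3, hc.covDeriv_frameField_zero h1 (c0 q) h2 (c0 q)]
    simp only [frameField, pd_const, mul_zero, sub_zero, zero_sub, add_zero, zero_add]
  have e1 : covDeriv (bcvMetric m l) (hopfCylinder x y) 1 W =ᶠ[nhds p] frameField m l x y u v
      (fun q => l / 2 * w q) (pd 1 w) (fun _ => 0) := by
    filter_upwards [hev] with q ⟨h1, h2, h3⟩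
    rw [covDeriv_congr 1 h3, hc.covDeriv_frameField_one h1 (c0 q) h2 (c0 q)]
    simp only [frameField, pd_const, mul_zero, sub_zero, zero_add]
  have d1 : DifferentiableAt ℝ (fun q => l / 2 * w q) p := by fun_prop
  have d2 : DifferentiableAt ℝ (fun q => -((geodesicCurvature m x y u v k (q 0)
      - l / 2 * slope l x y u v (q 0)) * w q)) p := by fun_prop
  unfold roughLaplacian
  rw [trace_conformal_hopf (hc.conformalMetric_eventuallyEq hp) hf hf0 ha
    (fun i j => covDeriv (bcvMetric m l) (hopfCylinder x y) i
      (covDeriv (bcvMetric m l) (hopfCylinder x y) j W) p b)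
    (fun t => covDeriv (bcvMetric m l) (hopfCylinder x y) t W p b)]
  simp only [covDeriv_congr _ e0, covDeriv_congr _ e1, congrFun e1.self_of_nhds b,
    hc.covDeriv_frameField_zero hp d2 hw0 d1, hc.covDeriv_frameField_one hp d2 hw0 d1,
    hc.covDeriv_frameField_zero hp d1 hw1 (c0 p), hc.covDeriv_frameField_one hp d1 hw1 (c0 p)]
  simp (disch := fun_prop) only [pd_const, pd_neg, pd_mul, pd_sub, ea, eκ, if_true,
    if_neg h10]
  revert b
  refine forall_fin_three ?_ ?_ ?_ <;>
    simp only [frameField, frameVector, Matrix.cons_val, a, κ, a', Xw] <;> ring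

theorem curvatureTrace_normal (hc : IsFramedCurve m I x y u v k) (hp : p 0 ∈ I)
    (hf : DifferentiableAt ℝ f p) (hf0 : f p ≠ 0)
    {W : (Fin 2 → ℝ) → (Fin 3 → ℝ)}
    (hW : W p = frameField m l x y u v (fun _ => 0) w (fun _ => 0) p) (b : Fin 3) :
    curvatureTrace (fun q => (f q)⁻¹ • pullbackMetric (bcvMetric m l) (hopfCylinder x y) q)
        (bcvMetric m l) (hopfCylinder x y) W p b =
      f p * frameVector m l (x (p 0)) (y (p 0)) (u (p 0)) (v (p 0))
        0 (-(4 * m - l ^ 2 / 2) * w p) 0 b := by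
  set T := horizontal m l (x (p 0)) (y (p 0)) (u (p 0)) (v (p 0)) with hT
  set N := horizontal m l (x (p 0)) (y (p 0)) (-v (p 0)) (u (p 0)) with hN
  have hF : factor m (hopfCylinder x y p 0) (hopfCylinder x y p 1) ≠ 0 :=
    (hc.factor_pos _ hp).ne'
  have h1 := curvature_bcvMetric_horizontal (l := l) hF (u (p 0)) (v (p 0)) b
  have h2 := curvature_bcvMetric_vertical (l := l) hF (-v (p 0)) (u (p 0)) b
  rw [hc.unit _ hp] at h1
  have hx : hopfCylinder x y p 0 = x (p 0) := rfl
  have hy : hopfCylinder x y p 1 = y (p 0) := rfl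
  rw [hx, hy, ← hN] at h1 h2
  rw [← hT] at h1
  have e0 (c : Fin 3) : pd 0 (fun q => hopfCylinder x y q c) p =
      T c + slope l x y u v (p 0) * vertical c := by
    have h := congrFun (hc.pd_hopfCylinder_zero (l := l) hp) c
    rw [h]
    revert c
    refine forall_fin_three ?_ ?_ ?_ <;> intro _ <;>
      simp only [frameField, frameVector, hT, horizontal, vertical, Matrix.cons_val] <;> ring
  have e1 (c : Fin 3) : pd 1 (fun q => hopfCylinder x y q c) p = vertical c := by
    have h := congrFun (hc.pd_hopfCylinder_one (l := l) hp) c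
    rw [h]
    revert c
    refine forall_fin_three ?_ ?_ ?_ <;> intro _ <;>
      simp only [frameField, frameVector, vertical, Matrix.cons_val] <;> ring
  have e2 (d : Fin 3) : W p d = w p * N d := by
    rw [hW]
    revert d
    refine forall_fin_three ?_ ?_ ?_ <;>
      simp only [frameField, frameVector, hN, horizontal, Matrix.cons_val] <;> ring
  have e3 : frameVector m l (x (p 0)) (y (p 0)) (u (p 0)) (v (p 0))
      0 (-(4 * m - l ^ 2 / 2) * w p) 0 b = -(4 * m - l ^ 2 / 2) * w p * N b := by
    clear h1 h2
    revert b
    refine forall_fin_three ?_ ?_ ?_ <;>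
      simp only [frameVector, hN, horizontal, Matrix.cons_val] <;> ring
  -- With P = 0 the trace formula applies to any bilinear form. Substituting ∂_s φ = T + a E₃ then
  -- cancels the mixed terms and leaves the planes (T, N) and (E₃, N).
  have key := trace_conformal_hopf (hc.conformalMetric_eventuallyEq hp) hf hf0
    (hc.hasDerivAt_slope (l := l) hp)
    (fun i j => ∑ b', ∑ c, ∑ d, curvature (bcvMetric m l) b b' c d (hopfCylinder x y p) *
      pd i (fun q => hopfCylinder x y q c) p * W p d * pd j (fun q => hopfCylinder x y q b') p)
    (fun _ => 0)
  simp only [mul_zero, Finset.sum_const_zero, sub_zero] at key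
  unfold curvatureTrace
  rw [key, e3]
  simp only [e0, e1, e2]
  simp only [Fin.sum_univ_three] at h1 h2 ⊢
  linear_combination f p * w p * (h1 + h2)

end IsFramedCurve

/-! ### Framing a curve parametrized by arclength -/

theorem contDiffAt_deriv {g : ℝ → ℝ} {s : ℝ} (h : ContDiffAt ℝ ∞ g s) :
    ContDiffAt ℝ ∞ (deriv g) s :=
  (h.fderiv_right (m := ∞) le_rfl).clm_apply contDiffAt_const

theorem IsBaseCurve.exists_isFramedCurve {m : ℝ} {I : Set ℝ} {x y : ℝ → ℝ}
    (h : IsBaseCurve m I x y) : ∃ u v k : ℝ → ℝ, IsFramedCurve m I x y u v k := by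
  have hx (s) (hs : s ∈ I) : ContDiffAt ℝ ∞ x s :=
    (h.smooth_x s hs).contDiffAt (h.isOpen.mem_nhds hs)
  have hy (s) (hs : s ∈ I) : ContDiffAt ℝ ∞ y s :=
    (h.smooth_y s hs).contDiffAt (h.isOpen.mem_nhds hs)
  have hF (s) (hs : s ∈ I) : ContDiffAt ℝ ∞ (fun s => factor m (x s) (y s)) s := by
    have := hx s hs
    have := hy s hs
    unfold factor
    fun_prop
  have hF0 (s) (hs : s ∈ I) : factor m (x s) (y s) ≠ 0 := (h.mem_base s hs).ne'
  set u : ℝ → ℝ := fun s => deriv x s / factor m (x s) (y s) with hu_def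
  set v : ℝ → ℝ := fun s => deriv y s / factor m (x s) (y s) with hv_def
  have hu (s) (hs : s ∈ I) : ContDiffAt ℝ ∞ u s :=
    (contDiffAt_deriv (hx s hs)).div (hF s hs) (hF0 s hs)
  have hv (s) (hs : s ∈ I) : ContDiffAt ℝ ∞ v s :=
    (contDiffAt_deriv (hy s hs)).div (hF s hs) (hF0 s hs)
  have hunit (s) (hs : s ∈ I) : u s ^ 2 + v s ^ 2 = 1 := by
    have := h.unit_speed s hs
    rw [← this, hu_def, hv_def]
    ring
  have hu' (s) (hs : s ∈ I) : HasDerivAt u (deriv u s) s :=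
    ((hu s hs).differentiableAt (by simp)).hasDerivAt
  have hv' (s) (hs : s ∈ I) : HasDerivAt v (deriv v s) s :=
    ((hv s hs).differentiableAt (by simp)).hasDerivAt
  have horth (s) (hs : s ∈ I) : u s * deriv u s + v s * deriv v s = 0 := by
    have h1 := ((hu' s hs).pow 2).add ((hv' s hs).pow 2)
    have h2 : u ^ 2 + v ^ 2 =ᶠ[nhds s] fun _ => (1 : ℝ) := by
      filter_upwards [h.isOpen.mem_nhds hs] with t ht using hunit t ht
    have h3 := h1.unique ((hasDerivAt_const s (1 : ℝ)).congr_of_eventuallyEq h2)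
    push_cast at h3
    linear_combination h3 / 2
  -- The rotation rate is uv' - vu'. With u² + v² = 1 and uu' + vv' = 0 it satisfies the Frenet
  -- equations, so no angle function has to be chosen.
  refine ⟨u, v, fun s => u s * deriv v s - v s * deriv u s, h.isOpen, hx, hy, hu, hv, ?_,
    h.mem_base, hunit, ?_, ?_, ?_, ?_⟩
  · intro s hs
    exact ((hu s hs).mul (contDiffAt_deriv (hv s hs))).sub
      ((hv s hs).mul (contDiffAt_deriv (hu s hs)))
  · intro s hs
    refine ((hx s hs).differentiableAt (by simp)).hasDerivAt.congr_deriv ?_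
    rw [hu_def]
    exact (mul_div_cancel₀ _ (hF0 s hs)).symm
  · intro s hs
    refine ((hy s hs).differentiableAt (by simp)).hasDerivAt.congr_deriv ?_
    rw [hv_def]
    exact (mul_div_cancel₀ _ (hF0 s hs)).symm
  · intro s hs
    refine (hu' s hs).congr_deriv ?_
    linear_combination (-deriv u s) * hunit s hs + u s * horth s hs
  · intro s hs
    refine (hv' s hs).congr_deriv ?_
    linear_combination (-deriv v s) * hunit s hs + v s * horth s hs

/-! ### The biharmonic system for w -/

namespace IsFramedCurve

variable {m l : ℝ} {I : Set ℝ} {x y u v k : ℝ → ℝ} {f : (Fin 2 → ℝ) → ℝ}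

/-- The three components of the equation `τ₂(φ) = 0`, in terms of the normal component `w` of the
tension field. -/
theorem bitension_hopfCylinder_eq_zero (hc : IsFramedCurve m I x y u v k) {U : Set (Fin 2 → ℝ)}
    (hU : IsOpen U) (hUI : U ⊆ {p | p 0 ∈ I}) (hf : ContDiffOn ℝ ∞ f U)
    (hf0 : ∀ p ∈ U, 0 < f p) {p : Fin 2 → ℝ} (hp : p ∈ U)
    (hb : bitension (fun q => (f q)⁻¹ • pullbackMetric (bcvMetric m l) (hopfCylinder x y) q)
      (bcvMetric m l) (hopfCylinder x y) p = 0) :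
    let a := slope l x y u v (p 0)
    let κ := geodesicCurvature m x y u v k (p 0)
    let a' := -(l / 2) * k (p 0) * (x (p 0) * u (p 0) + y (p 0) * v (p 0))
    let w := fun q : Fin 2 → ℝ => f q * geodesicCurvature m x y u v k (q 0)
    let Xw := pd 0 w p - a * pd 1 w p
    ContDiffAt ℝ ∞ w p ∧
    -2 * κ * Xw - w p * deriv (geodesicCurvature m x y u v k) (p 0) + l * pd 1 w p = 0 ∧
    pd 0 (pd 0 w) p - a' * pd 1 w p - a * pd 0 (pd 1 w) p - a * pd 1 (pd 0 w) p
      + (1 + a ^ 2) * pd 1 (pd 1 w) p - w p * (κ ^ 2 + l ^ 2 / 2) + (4 * m - l ^ 2 / 2) * w p = 0 ∧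
    l * Xw = 0 := by
  intro a κ a' w Xw
  have hfs (q) (hq : q ∈ U) : ContDiffAt ℝ ∞ f q := (hf q hq).contDiffAt (hU.mem_nhds hq)
  have hfd (q) (hq : q ∈ U) : DifferentiableAt ℝ f q := (hfs q hq).differentiableAt (by simp)
  have hw : ContDiffAt ℝ ∞ w p := by
    refine (hfs p hp).mul ?_
    exact (hc.contDiffAt_geodesicCurvature (hUI hp)).comp p (contDiff_apply ℝ ℝ 0).contDiffAt
  have hW : tension (fun q => (f q)⁻¹ • pullbackMetric (bcvMetric m l) (hopfCylinder x y) q)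
      (bcvMetric m l) (hopfCylinder x y) =ᶠ[nhds p]
      frameField m l x y u v (fun _ => 0) w (fun _ => 0) := by
    filter_upwards [hU.mem_nhds hp] with q hq
    exact hc.tension_hopfCylinder (hUI hq) (hfd q hq) (hf0 q hq).ne'
  refine ⟨hw, ?_⟩
  -- T, N, E₃ are independent, so the three coefficients vanish separately once the common factor f
  -- is removed.
  refine frameVector_eq_zero (m := m) (l := l) (hc.factor_pos _ (hUI hp)).ne'
    (hc.unit _ (hUI hp)) ?_
  funext b
  have hb' := congrFun hb b
  unfold bitension at hb'
  rw [hc.roughLaplacian_normal (hUI hp) (hfd p hp) (hf0 p hp).ne' hw hW,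
    hc.curvatureTrace_normal (hUI hp) (hfd p hp) (hf0 p hp).ne' hW.self_of_nhds,
    Pi.zero_apply, ← mul_sub] at hb'
  have hb2 := (mul_eq_zero.mp hb').resolve_left (hf0 p hp).ne'
  rw [Pi.zero_apply, ← hb2]
  clear hb2 hb'
  revert b
  refine forall_fin_three ?_ ?_ ?_ <;>
    simp only [frameVector, Matrix.cons_val, a, κ, a', Xw] <;> ring

end IsFramedCurve

/-! ### The case l ≠ 0 -/

/-- A proper biharmonic conformal immersion of a Hopf cylinder into `M³(m, l)` with `l ≠ 0` forces
`l² < 4 m`. -/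
theorem sq_lt_of_admits {m l : ℝ} (hl : l ≠ 0)
    (h : AdmitsProperBiharmonicConformalHopfCylinder m l) : l ^ 2 < 4 * m := by
  obtain ⟨I, x, y, U, f, h⟩ := h
  obtain ⟨u, v, k, hc⟩ := h.baseCurve.exists_isFramedCurve
  obtain ⟨hbi, hnh⟩ := h.properBiharmonic
  have heq (p) (hp : p ∈ U) :=
    hc.bitension_hopfCylinder_eq_zero h.isOpen h.subset h.smooth h.pos hp (hbi p hp)
  unfold IsHarmonicOn at hnh
  push Not at hnh
  obtain ⟨p, hp, hne⟩ := hnh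
  set κ := geodesicCurvature m x y u v k with hκ_def
  set a := slope l x y u v with ha_def
  set w : (Fin 2 → ℝ) → ℝ := fun q => f q * κ (q 0) with hw_def
  have hwp : w p ≠ 0 := by
    intro h0
    apply hne
    rw [hc.tension_hopfCylinder (h.subset hp)
      (((h.smooth p hp).contDiffAt (h.isOpen.mem_nhds hp)).differentiableAt (by simp))
      (h.pos p hp).ne']
    funext b
    have h0' : f p * geodesicCurvature m x y u v k (p 0) = 0 := h0
    revert b
    refine forall_fin_three ?_ ?_ ?_ <;> simp [frameField, frameVector, h0']
  have hws (q) (hq : q ∈ U) : ContDiffAt ℝ ∞ w q := (heq q hq).1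
  have hX (q) (hq : q ∈ U) : pd 0 w q = a (q 0) * pd 1 w q :=
    sub_eq_zero.mp ((mul_eq_zero.mp (heq q hq).2.2.2).resolve_left hl)
  have hV (q) (hq : q ∈ U) : pd 1 w q = l⁻¹ * (deriv κ (q 0) * w q) := by
    have h1 : -2 * κ (q 0) * (pd 0 w q - a (q 0) * pd 1 w q) - w q * deriv κ (q 0)
      + l * pd 1 w q = 0 := (heq q hq).2.1
    rw [hX q hq] at h1
    field_simp
    linear_combination h1
  have hκs (q : Fin 2 → ℝ) (hq : q ∈ U) : ContDiffAt ℝ ∞ κ (q 0) :=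
    hc.contDiffAt_geodesicCurvature (h.subset hq)
  have hκ1 (q : Fin 2 → ℝ) (hq : q ∈ U) : HasDerivAt κ (deriv κ (q 0)) (q 0) :=
    ((hκs q hq).differentiableAt (by simp)).hasDerivAt
  have hκ2 (q : Fin 2 → ℝ) (hq : q ∈ U) :
      HasDerivAt (deriv κ) (deriv (deriv κ) (q 0)) (q 0) :=
    ((contDiffAt_deriv (hκs q hq)).differentiableAt (by simp)).hasDerivAt
  -- Both relations keep the factor w, which may vanish elsewhere in U. The first is XZw = ZXw; the
  -- second is the normal equation with Xw = 0 and Zw = κ' w / l inserted.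
  have key (q) (hq : q ∈ U) : deriv (deriv κ) (q 0) * w q = 0 ∧
      (deriv κ (q 0) ^ 2 - l ^ 2 * (κ (q 0) ^ 2 + l ^ 2 - 4 * m)) * w q = 0 := by
    have hUq := h.isOpen.mem_nhds hq
    have ha := hc.hasDerivAt_slope (l := l) (h.subset hq)
    have had := ha.differentiableAt
    have hκ2d := (hκ2 q hq).differentiableAt
    have hwd : DifferentiableAt ℝ w q := (hws q hq).differentiableAt (by simp)
    have hw1 : DifferentiableAt ℝ (pd 1 w) q :=
      (contDiffAt_pd 1 (hws q hq)).differentiableAt (by simp)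
    have ea (i : Fin 2) := pd_comp_coord (n := 2) (p := q) i 0 ha
    have eκ (i : Fin 2) := pd_comp_coord (n := 2) (p := q) i 0 (hκ2 q hq)
    have h10 : ¬ (1 : Fin 2) = 0 := by decide
    have hX' (i : Fin 2) : pd i (pd 0 w) q = pd i (fun q => a (q 0) * pd 1 w q) q :=
      pd_congr i (Filter.eventually_of_mem hUq hX)
    have hV' (i : Fin 2) : pd i (pd 1 w) q = pd i (fun q => l⁻¹ * (deriv κ (q 0) * w q)) q :=
      pd_congr i (Filter.eventually_of_mem hUq hV)
    have h00 := hX' 0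
    have h10' := hX' 1
    have h01 := hV' 0
    have h11 := hV' 1
    simp (disch := fun_prop) only [pd_mul, pd_const, ha_def, ea, eκ, if_true, if_neg h10]
      at h00 h10' h01 h11
    have hcomm := pd_comm 0 1 (hws q hq)
    have hn := (heq q hq).2.2.1
    have hVq := hV q hq
    have hXq := hX q hq
    have e1 : l⁻¹ * (deriv (deriv κ) (q 0) * w q) = 0 := by
      linear_combination hcomm - h01 + h10' + a (q 0) * h11 - l⁻¹ * deriv κ (q 0) * hXq
    have e2 : pd 1 (pd 1 w) q = w q * (κ (q 0) ^ 2 + l ^ 2 - 4 * m) := by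
      linear_combination hn - h00 + a (q 0) * h10'
    have e3 : l ^ 2 * pd 1 (pd 1 w) q = deriv κ (q 0) ^ 2 * w q := by
      rw [h11, hVq]
      field_simp
      ring
    refine ⟨(mul_eq_zero.mp e1).resolve_left (inv_ne_zero hl), ?_⟩
    linear_combination l ^ 2 * e2 - e3
  have hev : ∀ᶠ q in nhds p, q ∈ U ∧ w q ≠ 0 :=
    Filter.Eventually.and (h.isOpen.mem_nhds hp) ((hws p hp).continuousAt.eventually_ne hwp)
  -- By continuity w ≠ 0 near p, so w cancels on a neighbourhood and the relation can be
  -- differentiated in s.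
  have hΦ : (fun q : Fin 2 → ℝ => deriv κ (q 0) ^ 2 - l ^ 2 * (κ (q 0) ^ 2 + l ^ 2 - 4 * m))
      =ᶠ[nhds p] fun _ => 0 :=
    hev.mono fun q hq => (mul_eq_zero.mp (key q hq.1).2).resolve_right hq.2
  have h1 := pd_congr 0 hΦ
  have eκ := pd_comp_coord (n := 2) (p := p) 0 0 (hκ1 p hp)
  have eκ' := pd_comp_coord (n := 2) (p := p) 0 0 (hκ2 p hp)
  have hκd := (hκ1 p hp).differentiableAt
  have hκd' := (hκ2 p hp).differentiableAt
  simp (disch := fun_prop) only [pd_sub, pd_mul, pd_add, pd_pow_two, pd_const, eκ, eκ', if_true]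
    at h1
  have h2 := (mul_eq_zero.mp (key p hp).1).resolve_right hwp
  have hκ0 : κ (p 0) ≠ 0 := right_ne_zero_of_mul hwp
  -- The derivative of the relation is 2κ'κ'' - 2l²κκ' = 0, and κ'' = 0 at p.
  have h3 : 2 * l ^ 2 * κ (p 0) * deriv κ (p 0) = 0 := by
    rw [h2] at h1
    linear_combination -h1
  have h4 : deriv κ (p 0) = 0 := (mul_eq_zero.mp h3).resolve_left (by positivity)
  have h5 : deriv κ (p 0) ^ 2 - l ^ 2 * (κ (p 0) ^ 2 + l ^ 2 - 4 * m) = 0 := hΦ.self_of_nhds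
  have h6 : l ^ 2 * (κ (p 0) ^ 2 + l ^ 2 - 4 * m) = 0 := by
    rw [h4] at h5
    linear_combination -h5
  have h7 := (mul_eq_zero.mp h6).resolve_left (by positivity)
  have h8 : 0 < κ (p 0) ^ 2 := by positivity
  linarith

end BCV

theorem mainTheorem12 (m l : ℝ) :
    (BCV.AdmitsProperBiharmonicConformalHopfCylinder m l →
      BCV.IsS2R m l ∨ BCV.IsH2R m l ∨ BCV.IsR3 m l ∨ BCV.IsSU2 m l) ∧
    (BCV.IsS3 m l ∨ BCV.IsSL2 m l ∨ BCV.IsNil m l →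
      ¬ BCV.AdmitsProperBiharmonicConformalHopfCylinder m l) := by
  constructor
  · intro h
    by_cases hl : l = 0
    · rcases lt_trichotomy m 0 with hm | hm | hm
      · exact Or.inr (Or.inl ⟨hm, hl⟩)
      · exact Or.inr (Or.inr (Or.inl ⟨hm, hl⟩))
      · exact Or.inl ⟨hm, hl⟩
    · have h1 := BCV.sq_lt_of_admits hl h
      exact Or.inr (Or.inr (Or.inr ⟨by nlinarith [sq_nonneg l], hl, h1.ne⟩))
  · rintro (⟨hm, hl⟩ | ⟨hm, hl⟩ | ⟨hm, hl⟩) h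
    · have hl0 : l ≠ 0 := by
        rintro rfl
        linarith
      exact (BCV.sq_lt_of_admits hl0 h).ne hl
    · nlinarith [BCV.sq_lt_of_admits hl h, sq_nonneg l]
    · nlinarith [BCV.sq_lt_of_admits hl h, sq_nonneg l]
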